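/- Consider the single secretary problem with $n \ge 1$ items: an instance consists of $n$ pairwise distinct real weights, which are presented one at a time in uniformly random order. A randomized algorithm (which may depend on $n$, and on a set $W$ from which the weights are known to be drawn) is given by numbers $a_i(v_1,\dots,v_i)\in[0,1]$, for $1\le i\le n$ and real $v_1,\dots,v_i$, where $a_i(v_1,\dots,v_i)$ is the probability that the algorithm stops at time $i$ and accepts the value $v_i$, conditioned on having seen $v_1,\dots,v_i$ in this order and on not having stopped before. It succeeds if the value that it accepts is the maximum weight of the instance. Theorem. For every $\varepsilon>0$ and every $\rho>1$ there exist an integer $n\ge 1$ and a finite set $W\subset\{1,\rho,\rho^2,\dots\}$ such that no randomized algorithm for the single secretary problem with $n$ items succeeds with probability at least $\frac1e+\varepsilon$ on every instance of $n$ pairwise distinct weights from $W$, where the probability is over the internal randomness of the algorithm and the random order of the items. In other words, for every randomized algorithm there is an instance of $n$ pairwise distinct weights from $W$ on which it selects the maximum with probability strictly less than $\frac1e+\varepsilon$. -/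

import Mathlib

/-- A randomized algorithm for the single secretary problem with `n` items:
`stopProb i (v₀, …, vᵢ)` is the probability that the algorithm stops at time `i` and accepts the
value `vᵢ`, conditioned on having seen the values `v₀, …, vᵢ` (in this order) and on not having
stopped at any earlier time. -/
structure SecretaryAlgorithm (n : ℕ) where
  stopProb : (i : Fin n) → (Fin (i.val + 1) → ℝ) → ℝ
  stopProb_nonneg : ∀ (i : Fin n) (h : Fin (i.val + 1) → ℝ), 0 ≤ stopProb i h
  stopProb_le_one : ∀ (i : Fin n) (h : Fin (i.val + 1) → ℝ), stopProb i h ≤ 1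

namespace SecretaryAlgorithm

/-- The part of the arrival sequence `u` that has been seen at time `i` (times `0, …, i`). -/
def seen {n : ℕ} (u : Fin n → ℝ) (i : Fin n) : Fin (i.val + 1) → ℝ :=
  fun j => u (Fin.castLE (Nat.succ_le_of_lt i.isLt) j)

/-- The probability, over the internal randomness of the algorithm, that it accepts the item
arriving at time `i`, when the values arrive in the order `u 0, u 1, …`: it must not stop at any
time `j < i` and must then stop at time `i`. -/
def acceptProb {n : ℕ} (a : SecretaryAlgorithm n) (u : Fin n → ℝ) (i : Fin n) : ℝ :=
  (∏ j ∈ Finset.univ.filter (fun j : Fin n => j < i), (1 - a.stopProb j (seen u j))) *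
    a.stopProb i (seen u i)

/-- The probability that the algorithm selects a maximum element of the instance with weights
`v 0, …, v (n - 1)`, over its internal randomness and over the arrival order: the item arriving at
time `i` is `σ i`, where `σ` is a uniformly random permutation. -/
noncomputable def successProb {n : ℕ} (a : SecretaryAlgorithm n) (v : Fin n → ℝ) : ℝ :=
  (∑ σ : Equiv.Perm (Fin n),
    ∑ i ∈ Finset.univ.filter (fun i : Fin n => ∀ j : Fin n, v j ≤ v (σ i)),
      a.acceptProb (fun t => v (σ t)) i) / (Nat.factorial n : ℝ)

/-- On every instance consisting of `n` pairwise distinct weights from `W`, the algorithm selects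
the maximum with probability at least `p`; that is, it is `1 / p`-probability competitive
over `W`. -/
def SelectsMaxWithProb {n : ℕ} (a : SecretaryAlgorithm n) (W : Finset ℝ) (p : ℝ) : Prop :=
  ∀ v : Fin n → ℝ, Function.Injective v → (∀ i, v i ∈ W) → p ≤ a.successProb v

end SecretaryAlgorithm

/-! ### A concave majorant of `t ↦ -t log t` and a linear programming bound -/

/-! Ultrafilter limits replace Ramsey's theorem in reducing an arbitrary algorithm to a rule that
sees only relative ranks. If every finite set of powers of `ρ` had a good algorithm, a pointwise
limit of these algorithms would be good on all powers at once
(`exists_algorithm_of_initial_segments`). Feed that algorithm weights `ρ ^ x i`, with `x` taken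
along the iterated hyperfilter. By `map_comp_iteratedHyperfilter_congr`, the limiting stopping
probabilities depend only on the relative order seen so far.

Relative ranks of a uniform permutation are independent and uniform. So if `y i` is the probability
of stopping at time `i` on a record, then `(i + 1) * y i + ∑ j < i, y j ≤ 1`, and the success
probability is at most `∑ (i + 1) / n * y i`. An explicit dual solution bounds this linear program
by `1 / e + 1 / n` (`secretary_lp_bound`), and `n` is chosen with `1 / n < ε`. -/

theorem neg_mul_log_tangent {a b : ℝ} (ha : 0 < a) (hb : 0 < b) :
    -(a * Real.log a) ≤ b - a * (1 + Real.log b) := by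
  have h := Real.log_le_sub_one_of_pos (div_pos hb ha)
  rw [Real.log_div hb.ne' ha.ne'] at h
  have h2 := mul_le_mul_of_nonneg_left h ha.le
  have h3 : a * (b / a - 1) = b - a := by field_simp
  rw [h3] at h2
  linarith

/-- The function equal to `1 / e` on `[0, 1 / e]` and to `-t log t` beyond. -/
noncomputable def secretaryTail (t : ℝ) : ℝ :=
  if t ≤ Real.exp (-1) then Real.exp (-1) else -(t * Real.log t)

/-- The negative of the derivative of `secretaryTail`. -/
noncomputable def secretaryDensity (t : ℝ) : ℝ := max 0 (1 + Real.log t)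

theorem secretaryDensity_nonneg (t : ℝ) : 0 ≤ secretaryDensity t := le_max_left _ _

theorem secretaryDensity_one : secretaryDensity 1 = 1 := by simp [secretaryDensity]

theorem secretaryTail_one : secretaryTail 1 = 0 := by simp [secretaryTail]

theorem secretaryTail_le (t : ℝ) : secretaryTail t ≤ Real.exp (-1) := by
  unfold secretaryTail
  split_ifs with h
  · exact le_rfl
  · have := neg_mul_log_tangent ((Real.exp_pos (-1)).trans (not_le.1 h)) (Real.exp_pos (-1))
    simpa using this

theorem secretaryTail_eq {b : ℝ} (hb : Real.exp (-1) ≤ b) :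
    secretaryTail b = -(b * Real.log b) ∧ secretaryDensity b = 1 + Real.log b := by
  have h1 : -1 ≤ Real.log b := (Real.le_log_iff_exp_le ((Real.exp_pos _).trans_le hb)).2 hb
  refine ⟨?_, max_eq_right (by linarith)⟩
  unfold secretaryTail
  split_ifs with h
  · simp [le_antisymm h hb]
  · rfl

theorem secretaryTail_eq_of_le {b : ℝ} (hb0 : 0 < b) (hb : b ≤ Real.exp (-1)) :
    secretaryTail b = Real.exp (-1) ∧ secretaryDensity b = 0 := by
  have h1 : Real.log b ≤ -1 := (Real.log_le_iff_le_exp hb0).2 hb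
  exact ⟨if_pos hb, max_eq_left (by linarith)⟩

/-- Concavity: `-t log t` peaks at `1 / e` with value `1 / e`, so the two pieces join smoothly and
the graph lies below each of its tangents. -/
theorem secretaryTail_tangent {a b : ℝ} (hb : 0 < b) :
    secretaryTail a ≤ secretaryTail b + secretaryDensity b * (b - a) := by
  rcases le_total b (Real.exp (-1)) with h | h
  · rw [(secretaryTail_eq_of_le hb h).1, (secretaryTail_eq_of_le hb h).2]
    simpa using secretaryTail_le a
  · have hd := secretaryDensity_nonneg b
    rw [(secretaryTail_eq h).2] at hd
    rw [(secretaryTail_eq h).1, (secretaryTail_eq h).2]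
    rcases le_total a (Real.exp (-1)) with h' | h'
    · have h3 : secretaryTail a = Real.exp (-1) := if_pos h'
      have := neg_mul_log_tangent (Real.exp_pos (-1)) hb
      rw [Real.log_exp] at this
      rw [h3]
      nlinarith [mul_le_mul_of_nonneg_right h' hd]
    · rw [(secretaryTail_eq h').1]
      have := neg_mul_log_tangent ((Real.exp_pos (-1)).trans_le h') hb
      linarith

/-- The continuous form of dual feasibility, tight for `t ≥ 1 / e`. -/
theorem le_mul_secretaryDensity_add_secretaryTail {t : ℝ} (ht : 0 < t) :
    t ≤ t * secretaryDensity t + secretaryTail t := by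
  rcases le_total t (Real.exp (-1)) with h | h
  · rw [(secretaryTail_eq_of_le ht h).1, (secretaryTail_eq_of_le ht h).2]
    simpa using h
  · rw [(secretaryTail_eq h).1, (secretaryTail_eq h).2]
    linarith

/-- The density is nondecreasing, so its right-endpoint Riemann sum over `[m / n, 1]` dominates its
integral `secretaryTail (m / n)`; tangent lines stand in for the integral. -/
theorem secretaryTail_le_sum (n : ℕ) (hn : 0 < n) (m : ℕ) (hm : m ≤ n) :
    secretaryTail (m / n) ≤ ∑ j ∈ Finset.Ico m n, secretaryDensity ((j + 1 : ℝ) / n) / n := by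
  have hn' : (0 : ℝ) < n := by exact_mod_cast hn
  induction hm using Nat.decreasingInduction with
  | self => simp [div_self hn'.ne', secretaryTail_one]
  | of_succ k hk ih =>
    rw [Finset.sum_eq_sum_Ico_succ_bot hk]
    push_cast at ih
    have := @secretaryTail_tangent (k / n) ((k + 1) / n) (by positivity)
    have h2 : ((k + 1 : ℝ) / n - k / n) = 1 / n := by ring
    rw [h2, mul_one_div] at this
    linarith

/-- Using tangents in the other direction, each term but the last is at most the integral over the
next cell. The last term, equal to `1 / n`, is the source of the error. -/
theorem sum_secretaryDensity_le (n : ℕ) (hn : 0 < n) :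
    ∑ j ∈ Finset.range n, secretaryDensity ((j + 1 : ℝ) / n) / n ≤ Real.exp (-1) + 1 / n := by
  have hn' : (0 : ℝ) < n := by exact_mod_cast hn
  have key : ∀ m < n, ∑ j ∈ Finset.range m, secretaryDensity ((j + 1 : ℝ) / n) / n ≤
      Real.exp (-1) - secretaryTail ((m + 1) / n) := by
    intro m
    induction m with
    | zero => intro _; simpa using secretaryTail_le _
    | succ m ih =>
      intro hm
      rw [Finset.sum_range_succ]
      have := @secretaryTail_tangent ((m + 1 + 1) / n) ((m + 1) / n) (by positivity)
      have h2 : ((m + 1 : ℝ) / n - (m + 1 + 1) / n) = -(1 / n) := by ring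
      rw [h2, mul_neg, mul_one_div] at this
      push_cast
      linarith [ih (by omega)]
  obtain ⟨m, rfl⟩ := Nat.exists_eq_succ_of_ne_zero hn.ne'
  rw [Finset.sum_range_succ]
  have h := key m (by omega)
  push_cast at h hn' ⊢
  rw [div_self hn'.ne', secretaryTail_one] at h
  rw [div_self hn'.ne', secretaryDensity_one]
  linarith

/-- The linear programming bound for the secretary problem. -/
theorem secretary_lp_bound (n : ℕ) (hn : 0 < n) (y : ℕ → ℝ) (hy : ∀ i, 0 ≤ y i)
    (h : ∀ i < n, (i + 1 : ℝ) * y i + ∑ j ∈ Finset.range i, y j ≤ 1) :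
    ∑ i ∈ Finset.range n, (i + 1 : ℝ) / n * y i ≤ Real.exp (-1) + 1 / n := by
  have hn' : (0 : ℝ) < n := by exact_mod_cast hn
  -- The dual solution: `c j` is the multiplier of the constraint at time `j`.
  set c : ℕ → ℝ := fun j => secretaryDensity ((j + 1 : ℝ) / n) / n with hc
  have hc0 : ∀ j, 0 ≤ c j := fun j => div_nonneg (secretaryDensity_nonneg _) hn'.le
  have hdual : ∀ i < n, (i + 1 : ℝ) / n ≤ (i + 1) * c i + ∑ j ∈ Finset.Ico (i + 1) n, c j := by
    intro i hi
    have h1 := secretaryTail_le_sum n hn (i + 1) hi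
    have h2 := @le_mul_secretaryDensity_add_secretaryTail ((i + 1) / n) (by positivity)
    push_cast at h1
    have h3 : (i + 1 : ℝ) * c i = (i + 1) / n * secretaryDensity ((i + 1) / n) := by
      simp only [hc]; ring
    rw [h3]
    linarith
  have hswap : ∑ i ∈ Finset.range n, (∑ j ∈ Finset.Ico (i + 1) n, c j) * y i =
      ∑ j ∈ Finset.range n, c j * ∑ i ∈ Finset.range j, y i := by
    simp only [Finset.sum_mul, Finset.mul_sum]
    refine Finset.sum_comm' fun i j => ?_
    simp only [Finset.mem_range, Finset.mem_Ico]
    omega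
  calc ∑ i ∈ Finset.range n, (i + 1 : ℝ) / n * y i
      ≤ ∑ i ∈ Finset.range n, ((i + 1) * c i + ∑ j ∈ Finset.Ico (i + 1) n, c j) * y i :=
        Finset.sum_le_sum fun i hi =>
          mul_le_mul_of_nonneg_right (hdual i (Finset.mem_range.1 hi)) (hy i)
    _ = ∑ i ∈ Finset.range n, c i * ((i + 1) * y i + ∑ j ∈ Finset.range i, y j) := by
        simp_rw [add_mul _ _ (y _), Finset.sum_add_distrib]
        rw [hswap, ← Finset.sum_add_distrib]
        exact Finset.sum_congr rfl fun i _ => by ring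
    _ ≤ ∑ i ∈ Finset.range n, c i * 1 :=
        Finset.sum_le_sum fun i hi =>
          mul_le_mul_of_nonneg_left (h i (Finset.mem_range.1 hi)) (hc0 i)
    _ ≤ Real.exp (-1) + 1 / n := by simpa using sum_secretaryDensity_le n hn

/-! ### Relative ranks of a permutation -/

/-- The number of earlier positions carrying a smaller value. -/
def relRank {n : ℕ} (σ : Equiv.Perm (Fin n)) (i : Fin n) : Fin (i.val + 1) :=
  ⟨((Finset.Iio i).filter fun j => σ j < σ i).card,
    Nat.lt_succ_of_le ((Finset.card_filter_le _ _).trans (by simp))⟩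

/-- Otherwise every earlier position below `i` under `τ` is also below `a` under `τ`, hence below
`i` under `σ`. Since `a` itself is counted only for `σ`, the two ranks at `i` would differ. -/
theorem lt_of_relRank_eq_aux {n : ℕ} {σ τ : Equiv.Perm (Fin n)} {i a : Fin n}
    (hi : relRank σ i = relRank τ i) (ha : a < i) (hσ : σ a < σ i)
    (ih : ∀ b < i, τ b < τ a → σ b < σ a) : τ a < τ i := by
  by_contra hcon
  have hlt : τ i < τ a := lt_of_le_of_ne (not_lt.1 hcon) fun h => ha.ne' (τ.injective h)
  have hss : ((Finset.Iio i).filter fun j => τ j < τ i) ⊂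
      ((Finset.Iio i).filter fun j => σ j < σ i) := by
    rw [Finset.ssubset_iff_of_subset]
    · exact ⟨a, by simp [ha, hσ], by simp [ha, hlt.le]⟩
    · intro j hj
      simp only [Finset.mem_filter, Finset.mem_Iio] at hj ⊢
      exact ⟨hj.1, (ih j hj.1 (hj.2.trans hlt)).trans hσ⟩
  have := Finset.card_lt_card hss
  have h2 := congrArg Fin.val hi
  simp only [relRank] at h2
  omega

/-- The relative ranks up to time `i` determine the relative order up to time `i`. -/
theorem lt_iff_lt_of_relRank_eq {n : ℕ} {σ τ : Equiv.Perm (Fin n)} (i : Fin n)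
    (h : ∀ j ≤ i, relRank σ j = relRank τ j) :
    ∀ a ≤ i, ∀ b ≤ i, σ a < σ b ↔ τ a < τ b := by
  induction i using WellFoundedLT.induction with
  | ind i ih =>
  have hprev : ∀ a < i, ∀ b < i, σ a < σ b ↔ τ a < τ b := fun a ha b hb =>
    ih (max a b) (max_lt ha hb) (fun j hj => h j (hj.trans (max_lt ha hb).le)) a
      (le_max_left _ _) b (le_max_right _ _)
  have hlast : ∀ a < i, σ a < σ i ↔ τ a < τ i := fun a ha =>
    ⟨fun hs => lt_of_relRank_eq_aux (h i le_rfl) ha hs fun b hb => (hprev b hb a ha).2,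
      fun hs => lt_of_relRank_eq_aux (h i le_rfl).symm ha hs fun b hb => (hprev b hb a ha).1⟩
  intro a ha b hb
  rcases ha.lt_or_eq with ha | rfl
  · rcases hb.lt_or_eq with hb | rfl
    · exact hprev a ha b hb
    · exact hlast a ha
  · rcases hb.lt_or_eq with hb | rfl
    · have h1 : σ a ≠ σ b := fun h => hb.ne' (σ.injective h)
      have h2 : τ a ≠ τ b := fun h => hb.ne' (τ.injective h)
      have := hlast b hb
      constructor
      · intro hs
        exact lt_of_le_of_ne (not_lt.1 fun h' => hs.not_gt (this.2 h')) h2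
      · intro hs
        exact lt_of_le_of_ne (not_lt.1 fun h' => hs.not_gt (this.1 h')) h1
    · simp

theorem relRank_injective (n : ℕ) :
    Function.Injective (relRank : Equiv.Perm (Fin n) → (i : Fin n) → Fin (i.val + 1)) := by
  intro σ τ h
  have key : ∀ a b, σ a < σ b ↔ τ a < τ b := fun a b =>
    lt_iff_lt_of_relRank_eq (max a b) (fun j _ => congrFun h j) a (le_max_left _ _) b
      (le_max_right _ _)
  -- Since `σ` and `τ` order all positions alike, `τ ∘ σ⁻¹` is an order automorphism of `Fin n`,
  -- hence the identity.
  have hm : StrictMono (σ.symm.trans τ) := fun x y hxy => by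
    have := (key (σ.symm x) (σ.symm y)).1 (by simpa using hxy)
    simpa using this
  have hid : (hm.orderIsoOfSurjective _ (σ.symm.trans τ).surjective) = OrderIso.refl (Fin n) :=
    Subsingleton.elim _ _
  ext a
  have := congrArg (fun e : Fin n ≃o Fin n => (e (σ a)).val) hid
  simpa using this.symm

/-- Both sides have `n!` elements. This is what makes relative ranks independent and uniform under a
uniform permutation. -/
theorem relRank_bijective (n : ℕ) :
    Function.Bijective (relRank : Equiv.Perm (Fin n) → (i : Fin n) → Fin (i.val + 1)) := by
  rw [Fintype.bijective_iff_injective_and_card]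
  refine ⟨relRank_injective n, ?_⟩
  rw [Fintype.card_perm, Fintype.card_pi, Fintype.card_fin]
  simp only [Fintype.card_fin]
  rw [Fin.prod_univ_eq_prod_range (fun i => i + 1) n, Finset.prod_range_add_one_eq_factorial]

/-- Ranks count from zero, so rank `i` at time `i` means a record. -/
theorem relRank_eq_of_isMax {n : ℕ} {σ : Equiv.Perm (Fin n)} {i : Fin n}
    (h : ∀ j, σ j ≤ σ i) : (relRank σ i).val = i := by
  simp only [relRank]
  rw [Finset.filter_true_of_mem, Fin.card_Iio]
  intro j hj
  exact lt_of_le_of_ne (h j) fun h' => (Finset.mem_Iio.1 hj).ne (σ.injective h')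

theorem relRank_ne_of_isMax {n : ℕ} {σ : Equiv.Perm (Fin n)} {i j : Fin n}
    (h : ∀ j, σ j ≤ σ i) (hij : i < j) : (relRank σ j).val ≠ j := by
  simp only [relRank]
  refine ne_of_lt ?_
  calc _ < (Finset.Iio j).card := Finset.card_lt_card <| by
          rw [Finset.ssubset_iff_of_subset (Finset.filter_subset _ _)]
          exact ⟨i, by simpa using hij, by simp [h j]⟩
    _ = j := by simp

/-! ### Stopping rules in independent relative ranks -/

/-- Independence of coordinate `i` from anything that ignores it, in counting form. The involution
exchanging `r i` with an auxiliary `x` matches the two double sums. -/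
theorem card_mul_sum_update_invariant {ι : Type*} [Fintype ι] [DecidableEq ι] {α : ι → Type*}
    [∀ i, Fintype (α i)] (i : ι) (f : α i → ℝ) (g : (∀ i, α i) → ℝ)
    (hg : ∀ r x, g (Function.update r i x) = g r) :
    (Fintype.card (α i) : ℝ) * ∑ r, f (r i) * g r = (∑ x, f x) * ∑ r, g r := by
  have h1 : (Fintype.card (α i) : ℝ) * ∑ r, f (r i) * g r =
      ∑ p : (∀ i, α i) × α i, f (p.1 i) * g p.1 := by
    rw [Fintype.sum_prod_type, Finset.mul_sum]
    simp
  have h2 : (∑ x, f x) * ∑ r, g r = ∑ p : (∀ i, α i) × α i, f p.2 * g p.1 := by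
    rw [Fintype.sum_prod_type, Finset.mul_sum]
    simp [Finset.sum_mul]
  rw [h1, h2]
  refine Finset.sum_nbij' (fun p => (Function.update p.1 i p.2, p.1 i))
    (fun p => (Function.update p.1 i p.2, p.1 i)) ?_ ?_ ?_ ?_ ?_ <;> simp [hg]

/-- The probability of stopping at time `i` when the conditional stopping probability at time `j`
is `b j`. -/
def stopAt {n : ℕ} {β : Type*} (b : Fin n → β → ℝ) (i : Fin n) (r : β) : ℝ :=
  (∏ j ∈ Finset.univ.filter (fun j : Fin n => j < i), (1 - b j r)) * b i r

section

variable {n : ℕ} {b : Fin n → (∀ i : Fin n, Fin (i.val + 1)) → ℝ}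

theorem stopAt_nonneg {β : Type*} {b : Fin n → β → ℝ} (h0 : ∀ i r, 0 ≤ b i r)
    (h1 : ∀ i r, b i r ≤ 1) (i : Fin n) (r : β) : 0 ≤ stopAt b i r :=
  mul_nonneg (Finset.prod_nonneg fun j _ => sub_nonneg.2 (h1 j r)) (h0 i r)

theorem prod_one_sub_eq_one_sub_sum_stopAt {β : Type*} (b : Fin n → β → ℝ) (i : Fin n) (r : β) :
    ∏ j ∈ Finset.univ.filter (fun j : Fin n => j < i), (1 - b j r) =
      1 - ∑ j ∈ Finset.univ.filter (fun j : Fin n => j < i), stopAt b j r := by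
  rw [Finset.prod_one_sub_ordered]
  congr 1
  refine Finset.sum_congr rfl fun j hj => ?_
  rw [stopAt, mul_comm, Finset.filter_filter]
  congr 1
  refine Finset.prod_congr ?_ fun _ _ => rfl
  ext k
  simp only [Finset.mem_filter, Finset.mem_univ, true_and] at hj ⊢
  exact ⟨fun h => h.2, fun h => ⟨h.trans hj, h⟩⟩

/-- The total weight of stopping at a record at time `i`. -/
noncomputable def recordMass (b : Fin n → (∀ i : Fin n, Fin (i.val + 1)) → ℝ) (i : Fin n) : ℝ :=
  ∑ r : (∀ i : Fin n, Fin (i.val + 1)),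
    (if (r i).val = i.val then 1 else 0) * stopAt b i r

theorem recordMass_nonneg (h0 : ∀ i r, 0 ≤ b i r) (h1 : ∀ i r, b i r ≤ 1) (i : Fin n) :
    0 ≤ recordMass b i :=
  Finset.sum_nonneg fun r _ => mul_nonneg (by split_ifs <;> simp) (stopAt_nonneg h0 h1 i r)

theorem sum_ite_val_eq (m : ℕ) : ∑ x : Fin (m + 1), (if x.val = m then (1 : ℝ) else 0) = 1 := by
  rw [Fin.sum_univ_castSucc]
  simp [Fin.val_castSucc, (Fin.is_lt _).ne]

theorem sum_ite_val_ne (m : ℕ) : ∑ x : Fin (m + 1), (if x.val ≠ m then (1 : ℝ) else 0) = m := by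
  rw [Fin.sum_univ_castSucc]
  simp [Fin.val_castSucc, (Fin.is_lt _).ne]

/-- Having survived to time `i` is independent of the rank at time `i`, which is a record for one
value in `i + 1`. Survival loses all earlier stopping mass, in particular that on records. Masses
are unnormalized, hence `n!`. -/
theorem recordMass_le (h0 : ∀ i r, 0 ≤ b i r) (h1 : ∀ i r, b i r ≤ 1)
    (hb : ∀ i r s, (∀ j ≤ i, r j = s j) → b i r = b i s) (i : Fin n) :
    (i + 1 : ℝ) * recordMass b i +
      ∑ j ∈ Finset.univ.filter (fun j : Fin n => j < i), recordMass b j ≤ n.factorial := by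
  set S : (∀ i : Fin n, Fin (i.val + 1)) → ℝ := fun r =>
    ∏ j ∈ Finset.univ.filter (fun j : Fin n => j < i), (1 - b j r) with hS
  have hS0 : ∀ r, 0 ≤ S r := fun r => Finset.prod_nonneg fun j _ => sub_nonneg.2 (h1 j r)
  have hSu : ∀ r x, S (Function.update r i x) = S r := by
    intro r x
    refine Finset.prod_congr rfl fun j hj => ?_
    rw [hb j _ r]
    intro k hk
    exact Function.update_of_ne (hk.trans_lt (Finset.mem_filter.1 hj).2).ne _ _
  have hind := card_mul_sum_update_invariant i
    (fun x : Fin (i.val + 1) => if x.val = i.val then (1 : ℝ) else 0) S hSu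
  rw [sum_ite_val_eq, Fintype.card_fin, one_mul] at hind
  push_cast at hind
  have hle : recordMass b i ≤ ∑ r : (∀ i : Fin n, Fin (i.val + 1)),
      (if (r i).val = i.val then (1 : ℝ) else 0) * S r :=
    Finset.sum_le_sum fun r _ => mul_le_mul_of_nonneg_left
      (mul_le_of_le_one_right (hS0 r) (h1 i r)) (by split_ifs <;> simp)
  have hsum : ∑ r, S r = n.factorial -
      ∑ j ∈ Finset.univ.filter (fun j : Fin n => j < i), ∑ r, stopAt b j r := by
    rw [Finset.sum_comm]
    simp only [hS, prod_one_sub_eq_one_sub_sum_stopAt, Finset.sum_sub_distrib]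
    congr 1
    rw [Finset.sum_const, Finset.card_univ, Fintype.card_pi]
    simp only [Fintype.card_fin]
    rw [Fin.prod_univ_eq_prod_range (fun i => i + 1) n, Finset.prod_range_add_one_eq_factorial]
    simp
  have hle2 : ∑ j ∈ Finset.univ.filter (fun j : Fin n => j < i), recordMass b j ≤
      ∑ j ∈ Finset.univ.filter (fun j : Fin n => j < i), ∑ r, stopAt b j r :=
    Finset.sum_le_sum fun j _ => Finset.sum_le_sum fun r _ =>
      mul_le_of_le_one_left (stopAt_nonneg h0 h1 j r) (by split_ifs <;> simp)
  have := mul_le_mul_of_nonneg_left hle (by positivity : (0 : ℝ) ≤ (i : ℝ) + 1)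
  linarith

/-- A record at time `i` remains the maximum up to time `m` with probability `(i + 1) / m`. -/
theorem mul_sum_record_remains
    (hb : ∀ i r s, (∀ j ≤ i, r j = s j) → b i r = b i s) (i : Fin n) (m : ℕ)
    (him : i.val + 1 ≤ m) (hmn : m ≤ n) :
    (m : ℝ) * ∑ r : (∀ i : Fin n, Fin (i.val + 1)),
      (if ∀ j : Fin n, i < j → j.val < m → (r j).val ≠ j.val then (1 : ℝ) else 0) *
      ((if (r i).val = i.val then 1 else 0) * stopAt b i r) = (i + 1) * recordMass b i := by
  induction m, him using Nat.le_induction with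
  | base =>
    unfold recordMass
    push_cast
    congr 1
    refine Finset.sum_congr rfl fun r _ => ?_
    rw [if_pos fun j h1 h2 => absurd (Fin.lt_def.1 h1) (by omega), one_mul]
  | succ m him ih =>
    rw [← ih (by omega)]
    -- The rank at time `m` avoids a record in `m` of its `m + 1` values, independently of all that
    -- the summand has used so far.
    have hind := card_mul_sum_update_invariant (⟨m, by omega⟩ : Fin n)
      (fun x : Fin (m + 1) => if x.val ≠ m then (1 : ℝ) else 0)
      (fun r => (if ∀ j : Fin n, i < j → j.val < m → (r j).val ≠ j.val then (1 : ℝ) else 0) *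
        ((if (r i).val = i.val then 1 else 0) * stopAt b i r)) ?_
    · rw [sum_ite_val_ne, Fintype.card_fin] at hind
      rw [← hind]
      congr 1
      refine Finset.sum_congr rfl fun r _ => ?_
      rw [← mul_assoc (ite ((r (⟨m, by omega⟩ : Fin n)).val ≠ m) _ _), ite_zero_mul_ite_zero,
        mul_one]
      congr 1
      refine if_congr ⟨fun h => ⟨h ⟨m, by omega⟩ (Fin.lt_def.2 (by simp; omega)) (by simp),
        fun j h1 h2 => h j h1 (by omega)⟩, fun h j h1 h2 => ?_⟩ rfl rfl
      rcases Nat.lt_succ_iff_lt_or_eq.1 h2 with h3 | h3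
      · exact h.2 j h1 h3
      · subst h3
        exact h.1
    · intro r x
      have hne : ∀ j : Fin n, j.val < m →
          Function.update r (⟨m, by omega⟩ : Fin n) x j = r j := fun j hj =>
        Function.update_of_ne (fun h => by rw [h] at hj; simp at hj) _ _
      have hb' : ∀ j ≤ i, b j (Function.update r (⟨m, by omega⟩ : Fin n) x) = b j r :=
        fun j hj => hb j _ _ fun k hk => hne k (by
          have := Fin.le_def.1 (hk.trans hj)
          omega)
      congr 1
      · refine if_congr (forall_congr' fun j => forall_congr' fun _ =>
          forall_congr' fun hj => ?_) rfl rfl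
        rw [hne j hj]
      · rw [hne i (by omega)]
        congr 1
        unfold stopAt
        rw [hb' i le_rfl]
        congr 1
        exact Finset.prod_congr rfl fun j hj => by rw [hb' j (Finset.mem_filter.1 hj).2.le]

end

/-- A stopping rule which observes relative ranks only succeeds with probability at most
`1 / e + 1 / n`. -/
theorem rank_rule_success_le {n : ℕ} (hn : 0 < n) (b : Fin n → Equiv.Perm (Fin n) → ℝ)
    (h0 : ∀ i σ, 0 ≤ b i σ) (h1 : ∀ i σ, b i σ ≤ 1)
    (hb : ∀ i σ τ, (∀ j ≤ i, relRank σ j = relRank τ j) → b i σ = b i τ) :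
    (∑ σ : Equiv.Perm (Fin n), ∑ i ∈ Finset.univ.filter (fun i : Fin n => ∀ j, σ j ≤ σ i),
      stopAt b i σ) / (n.factorial : ℝ) ≤ Real.exp (-1) + 1 / n := by
  have hn' : (0 : ℝ) < n := by exact_mod_cast hn
  have hf : (0 : ℝ) < n.factorial := by exact_mod_cast n.factorial_pos
  set e := Equiv.ofBijective _ (relRank_bijective n)
  set c : Fin n → (∀ i : Fin n, Fin (i.val + 1)) → ℝ := fun i r => b i (e.symm r) with hc
  have hrel : ∀ r, relRank (e.symm r) = r := fun r => e.apply_symm_apply r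
  have hc0 : ∀ i r, 0 ≤ c i r := fun i r => h0 _ _
  have hc1 : ∀ i r, c i r ≤ 1 := fun i r => h1 _ _
  have hcb : ∀ i r s, (∀ j ≤ i, r j = s j) → c i r = c i s := fun i r s h =>
    hb _ _ _ fun j hj => by rw [hrel, hrel, h j hj]
  set y : ℕ → ℝ := fun i => if h : i < n then recordMass c ⟨i, h⟩ / n.factorial else 0 with hy
  have hyv : ∀ i : Fin n, y i = recordMass c i / n.factorial := fun i => by simp [hy]
  have hlp := secretary_lp_bound n hn y ?_ ?_
  · refine le_trans ?_ hlp
    rw [div_le_iff₀ hf, ← Fin.sum_univ_eq_sum_range (fun i => (i + 1 : ℝ) / n * y i), Finset.sum_mul]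
    -- The overall maximum is a record followed by no further record; this one implication suffices
    -- for an upper bound.
    calc ∑ σ : Equiv.Perm (Fin n), ∑ i ∈ Finset.univ.filter (fun i : Fin n => ∀ j, σ j ≤ σ i),
          stopAt b i σ
        ≤ ∑ σ : Equiv.Perm (Fin n), ∑ i : Fin n,
          (if ∀ j : Fin n, i < j → j.val < n → (e σ j).val ≠ j.val then (1 : ℝ) else 0) *
            ((if (e σ i).val = i.val then 1 else 0) * stopAt c i (e σ)) := by
          refine Finset.sum_le_sum fun σ _ => ?_
          rw [Finset.sum_filter]
          refine Finset.sum_le_sum fun i _ => ?_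
          by_cases hi : ∀ j, σ j ≤ σ i
          · have h2 : ∀ j : Fin n, i < j → j.val < n → (e σ j).val ≠ j.val :=
              fun j hj _ => relRank_ne_of_isMax hi hj
            have h3 : (e σ i).val = i.val := relRank_eq_of_isMax hi
            rw [if_pos hi, if_pos h2, if_pos h3]
            simp [stopAt, hc]
          · rw [if_neg hi]
            exact mul_nonneg (by split_ifs <;> simp)
              (mul_nonneg (by split_ifs <;> simp) (stopAt_nonneg hc0 hc1 _ _))
      _ = ∑ i : Fin n, ∑ r : (∀ i : Fin n, Fin (i.val + 1)),
          (if ∀ j : Fin n, i < j → j.val < n → (r j).val ≠ j.val then (1 : ℝ) else 0) *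
            ((if (r i).val = i.val then 1 else 0) * stopAt c i r) := by
          rw [e.sum_comp (fun r => ∑ i : Fin n,
            (if ∀ j : Fin n, i < j → j.val < n → (r j).val ≠ j.val then (1 : ℝ) else 0) *
              ((if (r i).val = i.val then 1 else 0) * stopAt c i r)), Finset.sum_comm]
      _ ≤ _ := by
          refine Finset.sum_le_sum fun i _ => le_of_eq ?_
          rw [hyv]
          have := mul_sum_record_remains hcb i n i.isLt le_rfl
          rw [mul_assoc, div_mul_cancel₀ _ hf.ne', div_mul_eq_mul_div, ← this,
            mul_div_cancel_left₀ _ hn'.ne']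
  · intro i
    simp only [hy]
    split_ifs
    · exact div_nonneg (recordMass_nonneg hc0 hc1 _) hf.le
    · exact le_rfl
  · intro i hi
    have := recordMass_le hc0 hc1 hcb ⟨i, hi⟩
    have hs : ∑ j ∈ Finset.range i, y j =
        (∑ j ∈ Finset.univ.filter (fun j : Fin n => j < ⟨i, hi⟩), recordMass c j) /
          n.factorial := by
      rw [Finset.sum_div]
      symm
      refine Finset.sum_nbij (fun j => j.val) ?_ ?_ ?_ ?_
      · intro j hj
        simpa [Fin.lt_def] using hj
      · exact Fin.val_injective.injOn
      · intro j hj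
        have hj' := Finset.mem_range.1 hj
        exact ⟨⟨j, hj'.trans hi⟩, by simpa [Fin.lt_def] using hj', rfl⟩
      · intro j _
        exact (hyv j).symm
    rw [hs, hyv ⟨i, hi⟩, ← mul_div_assoc, ← add_div, div_le_one hf]
    exact this

/-! ### Iterated ultrafilter limits -/

/-- The `n`-fold iterate of the hyperfilter on `ℕ`, concentrated on increasing sequences. -/
noncomputable def iteratedHyperfilter : (n : ℕ) → Ultrafilter (Fin n → ℕ)
  | 0 => pure Fin.elim0
  | n + 1 => (Filter.hyperfilter ℕ).bind fun k => (iteratedHyperfilter n).map (Fin.cons k)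

theorem mem_iteratedHyperfilter_succ {n : ℕ} {s : Set (Fin (n + 1) → ℕ)} :
    s ∈ iteratedHyperfilter (n + 1) ↔
      ∀ᶠ k in Filter.hyperfilter ℕ, ∀ᶠ x in iteratedHyperfilter n, Fin.cons k x ∈ s :=
  Iff.rfl

theorem eventually_lt_iteratedHyperfilter (n k : ℕ) :
    ∀ᶠ x : Fin n → ℕ in iteratedHyperfilter n, ∀ i, k < x i := by
  induction n with
  | zero => exact Filter.Eventually.of_forall fun x i => i.elim0
  | succ n ih =>
    refine mem_iteratedHyperfilter_succ.2 ?_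
    filter_upwards [Nat.hyperfilter_le_atTop (Filter.eventually_gt_atTop k)] with l hl
    filter_upwards [ih] with x hx
    exact Fin.forall_fin_succ.2 ⟨hl, hx⟩

theorem eventually_strictMono_iteratedHyperfilter (n : ℕ) :
    ∀ᶠ x : Fin n → ℕ in iteratedHyperfilter n, StrictMono x := by
  induction n with
  | zero => exact Filter.Eventually.of_forall fun x i => i.elim0
  | succ n ih =>
    refine mem_iteratedHyperfilter_succ.2 (Filter.Eventually.of_forall fun k => ?_)
    filter_upwards [ih, eventually_lt_iteratedHyperfilter n k] with x hx hk
    intro i j hij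
    induction j using Fin.cases with
    | zero => exact absurd hij (Fin.not_lt_zero i)
    | succ j =>
      induction i using Fin.cases with
      | zero => exact hk j
      | succ i => exact hx (Fin.succ_lt_succ_iff.1 hij)

/-- Indiscernibility: an increasing subsequence has the same law. If `e` skips the first coordinate,
the outer quantifier over `k` is vacuous; otherwise `e` fixes `0` and the same `k` is peeled off
both sides. -/
theorem map_comp_iteratedHyperfilter_of_strictMono {m n : ℕ} (e : Fin m → Fin n)
    (he : StrictMono e) :
    (iteratedHyperfilter n).map (fun x => x ∘ e) = iteratedHyperfilter m := by
  induction n generalizing m with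
  | zero =>
    obtain rfl : m = 0 := by
      by_contra h
      exact (e ⟨0, Nat.pos_of_ne_zero h⟩).elim0
    ext s
    rw [Ultrafilter.mem_map]
    have : (fun x : Fin 0 → ℕ => x ∘ e) = id := funext fun x => Subsingleton.elim _ _
    rw [this]
    rfl
  | succ n ih =>
    by_cases h : ∀ i, e i ≠ 0
    · have hm : StrictMono (fun i => (e i).pred (h i)) := fun i j hij => by
        simpa using he hij
      ext s
      rw [Ultrafilter.mem_map, mem_iteratedHyperfilter_succ]
      have key : ∀ k : ℕ, (∀ᶠ x in iteratedHyperfilter n,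
          (Fin.cons k x : Fin (n + 1) → ℕ) ∈ (fun x : Fin (n + 1) → ℕ => x ∘ e) ⁻¹' s) ↔
            s ∈ iteratedHyperfilter m := by
        intro k
        rw [← ih _ hm, Ultrafilter.mem_map]
        have : ∀ x : Fin n → ℕ, (Fin.cons k x : Fin (n + 1) → ℕ) ∘ e =
            x ∘ fun i => (e i).pred (h i) := fun x => funext fun i => by
          conv_lhs => rw [Function.comp_apply, ← Fin.succ_pred (e i) (h i), Fin.cons_succ]
          rfl
        simp only [Set.mem_preimage, this]
        rfl
      simp only [key, Filter.eventually_const]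
    · push Not at h
      obtain ⟨i, hi⟩ := h
      obtain ⟨m, rfl⟩ : ∃ k, m = k + 1 := ⟨m - 1, by have := i.isLt; omega⟩
      have h00 : e 0 = 0 := le_antisymm (hi ▸ he.monotone (Fin.zero_le i)) (Fin.zero_le _)
      have hne : ∀ i : Fin m, e i.succ ≠ 0 := fun i => by
        have := he (Fin.succ_pos i)
        rw [h00] at this
        exact this.ne'
      have hm : StrictMono (fun i : Fin m => (e i.succ).pred (hne i)) := fun i j hij => by
        simpa using he (Fin.succ_lt_succ_iff.2 hij)
      ext s
      rw [Ultrafilter.mem_map, mem_iteratedHyperfilter_succ, mem_iteratedHyperfilter_succ]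
      refine Filter.eventually_congr (Filter.Eventually.of_forall fun k => ?_)
      rw [← ih _ hm, Ultrafilter.coe_map, Filter.eventually_map]
      have : ∀ x : Fin n → ℕ, (Fin.cons k x : Fin (n + 1) → ℕ) ∘ e =
          Fin.cons k (x ∘ fun i : Fin m => (e i.succ).pred (hne i)) := fun x => funext fun i => by
        induction i using Fin.cases with
        | zero => simp [h00]
        | succ i =>
          conv_lhs => rw [Function.comp_apply, ← Fin.succ_pred (e i.succ) (hne i), Fin.cons_succ]
          rfl
      simp only [Set.mem_preimage, this]

/-- Sampling coordinates from the iterated hyperfilter depends only on the relative order of the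
sampled positions. -/
theorem map_comp_iteratedHyperfilter_congr {m n : ℕ} {s t : Fin m → Fin n}
    (hs : Function.Injective s) (hst : ∀ a b, s a < s b ↔ t a < t b) :
    (iteratedHyperfilter n).map (fun x => x ∘ s) =
      (iteratedHyperfilter n).map (fun x => x ∘ t) := by
  -- One permutation sorts both `s` and `t`, so both reduce to the increasing case followed by the
  -- same rearrangement.
  have hsm : StrictMono (s ∘ Tuple.sort s) :=
    (Tuple.monotone_sort s).strictMono_of_injective (hs.comp (Tuple.sort s).injective)
  have htm : StrictMono (t ∘ Tuple.sort s) := fun a b hab => (hst _ _).1 (hsm hab)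
  have key : ∀ u : Fin m → Fin n, StrictMono (u ∘ Tuple.sort s) →
      (iteratedHyperfilter n).map (fun x => x ∘ u) =
        (iteratedHyperfilter m).map (fun x => x ∘ (Tuple.sort s).symm) := by
    intro u hu
    rw [← map_comp_iteratedHyperfilter_of_strictMono _ hu, Ultrafilter.map_map]
    congr 1
    ext x a
    simp
  rw [key s hsm, key t htm]

/-! ### Limits of algorithms and reduction to rank rules -/

theorem Ultrafilter.exists_tendsto_mem_Icc {α : Type*} (U : Ultrafilter α) (f : α → ℝ)
    (hf : ∀ x, f x ∈ Set.Icc (0 : ℝ) 1) :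
    ∃ l ∈ Set.Icc (0 : ℝ) 1, Filter.Tendsto f U (nhds l) := by
  obtain ⟨l, hl, h⟩ := isCompact_Icc.ultrafilter_le_nhds (U.map f)
    (Filter.le_principal_iff.2 (Filter.univ_mem' (f := (U : Filter α)) hf))
  exact ⟨l, hl, h⟩

open SecretaryAlgorithm in
/-- By compactness, guarantees on each initial segment of the powers of `ρ` give a single algorithm
with the same guarantee on all powers of `ρ`. -/
theorem exists_algorithm_of_initial_segments {n : ℕ} {ρ p : ℝ}
    (h : ∀ m : ℕ, ∃ a : SecretaryAlgorithm n,
      a.SelectsMaxWithProb ((Finset.range m).image fun k => ρ ^ k) p) :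
    ∃ a : SecretaryAlgorithm n, ∀ v : Fin n → ℝ, Function.Injective v →
      (∀ i, v i ∈ Set.range fun k : ℕ => ρ ^ k) → p ≤ a.successProb v := by
  choose A hA using h
  choose q hq01 hq using fun (i : Fin n) (w : Fin (i.val + 1) → ℝ) =>
    (Filter.hyperfilter ℕ).exists_tendsto_mem_Icc (fun m => (A m).stopProb i w)
      fun m => ⟨(A m).stopProb_nonneg i w, (A m).stopProb_le_one i w⟩
  refine ⟨⟨q, fun i w => (hq01 i w).1, fun i w => (hq01 i w).2⟩, fun v hv hvW => ?_⟩
  choose k hk using hvW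
  have hlim : Filter.Tendsto (fun m => (A m).successProb v) (Filter.hyperfilter ℕ)
      (nhds (successProb ⟨q, fun i w => (hq01 i w).1, fun i w => (hq01 i w).2⟩ v)) :=
    (tendsto_finsetSum _ fun σ _ => tendsto_finsetSum _ fun i _ =>
      (tendsto_finsetProd _ fun j _ => tendsto_const_nhds.sub (hq j _)).mul (hq i _)).div_const _
  refine ge_of_tendsto hlim ?_
  -- A fixed instance uses finitely many exponents, so it lies in every sufficiently long initial
  -- segment.
  have hev : ∀ᶠ m in Filter.atTop, ∀ i, k i < m :=
    Filter.eventually_all.2 fun i => Filter.eventually_gt_atTop (k i)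
  filter_upwards [Nat.hyperfilter_le_atTop hev] with m hm
  exact hA m v hv fun i => Finset.mem_image.2 ⟨k i, Finset.mem_range.2 (hm i), hk i⟩

open SecretaryAlgorithm in
/-- No algorithm has a guarantee above `1 / e + 1 / n` on all powers of `ρ`. -/
theorem le_of_forall_powers_le_successProb {n : ℕ} (hn : 0 < n) {ρ p : ℝ} (hρ : 1 < ρ)
    (a : SecretaryAlgorithm n) (h : ∀ v : Fin n → ℝ, Function.Injective v →
      (∀ i, v i ∈ Set.range fun k : ℕ => ρ ^ k) → p ≤ a.successProb v) :
    p ≤ Real.exp (-1) + 1 / n := by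
  -- The limit rule: for each arrival order `σ`, the limiting probability of stopping at time `i` as
  -- the exponents `x` run along the iterated hyperfilter.
  choose b hb01 hb using fun (i : Fin n) (σ : Equiv.Perm (Fin n)) =>
    (iteratedHyperfilter n).exists_tendsto_mem_Icc
      (fun x => a.stopProb i (seen (fun t => ρ ^ x (σ t)) i))
      fun x => ⟨a.stopProb_nonneg i _, a.stopProb_le_one i _⟩
  have hpat : ∀ i σ τ, (∀ j ≤ i, relRank σ j = relRank τ j) → b i σ = b i τ := by
    intro i σ τ hστ
    have hcast : ∀ c : Fin (i.val + 1), Fin.castLE (Nat.succ_le_of_lt i.isLt) c ≤ i := fun c =>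
      Fin.le_def.2 (Nat.lt_succ_iff.1 c.isLt)
    have hmap := map_comp_iteratedHyperfilter_congr
      (s := fun c => σ (Fin.castLE (Nat.succ_le_of_lt i.isLt) c))
      (t := fun c => τ (Fin.castLE (Nat.succ_le_of_lt i.isLt) c))
      (σ.injective.comp (Fin.castLE_injective _))
      fun c d => lt_iff_lt_of_relRank_eq i hστ _ (hcast c) _ (hcast d)
    set F : (Fin (i.val + 1) → ℕ) → ℝ := fun w => a.stopProb i fun c => ρ ^ w c
    -- The stopping probability is one function `F` of the exponents seen, whose law is the same for
    -- `σ` and `τ` by `hmap`; limits are unique.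
    have hF : ∀ π : Equiv.Perm (Fin n), Filter.Tendsto F ((iteratedHyperfilter n).map
        (fun x => x ∘ fun c => π (Fin.castLE (Nat.succ_le_of_lt i.isLt) c))) (nhds (b i π)) :=
      fun π => Filter.tendsto_map'_iff.2 (hb i π)
    have h2 := hF τ
    rw [← hmap] at h2
    exact tendsto_nhds_unique (hF σ) h2
  refine le_trans ?_ (rank_rule_success_le hn b (fun i σ => (hb01 i σ).1)
    (fun i σ => (hb01 i σ).2) hpat)
  have hlim : Filter.Tendsto (fun x : Fin n → ℕ => (∑ σ : Equiv.Perm (Fin n),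
      ∑ i ∈ Finset.univ.filter (fun i : Fin n => ∀ j, σ j ≤ σ i),
        a.acceptProb (fun t => ρ ^ x (σ t)) i) / (n.factorial : ℝ)) (iteratedHyperfilter n)
      (nhds ((∑ σ : Equiv.Perm (Fin n),
        ∑ i ∈ Finset.univ.filter (fun i : Fin n => ∀ j, σ j ≤ σ i), stopAt b i σ) /
          (n.factorial : ℝ))) :=
    (tendsto_finsetSum _ fun σ _ => tendsto_finsetSum _ fun i _ =>
      (tendsto_finsetProd _ fun j _ => tendsto_const_nhds.sub (hb j _)).mul (hb i _)).div_const _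
  refine ge_of_tendsto hlim ?_
  filter_upwards [eventually_strictMono_iteratedHyperfilter n] with x hx
  have hmono : StrictMono fun i => ρ ^ x i := (pow_right_strictMono₀ hρ).comp hx
  refine (h _ hmono.injective fun i => ⟨x i, rfl⟩).trans_eq ?_
  unfold successProb
  congr 1
  -- For increasing exponents, the item of maximum weight is the one of largest index.
  refine Finset.sum_congr rfl fun σ _ => Finset.sum_congr ?_ fun _ _ => rfl
  ext i
  simp only [Finset.mem_filter, Finset.mem_univ, true_and, hmono.le_iff_le]
  exact ⟨fun h j => h _, fun h j => by simpa using h (σ.symm j)⟩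

theorem mainTheorem4 (ε : ℝ) (hε : 0 < ε) (ρ : ℝ) (hρ : 1 < ρ) :
    ∃ n : ℕ, 1 ≤ n ∧ ∃ W : Finset ℝ,
      (W : Set ℝ) ⊆ Set.range (fun k : ℕ => ρ ^ k) ∧
      ¬ ∃ a : SecretaryAlgorithm n, a.SelectsMaxWithProb W (1 / Real.exp 1 + ε) := by
  obtain ⟨n, hn⟩ := exists_nat_one_div_lt hε
  refine ⟨n + 1, by omega, ?_⟩
  by_contra hcon
  push Not at hcon
  obtain ⟨a, ha⟩ := exists_algorithm_of_initial_segments (n := n + 1) (ρ := ρ)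
    (p := 1 / Real.exp 1 + ε) fun m => hcon _ (by
      intro x hx
      obtain ⟨k, _, rfl⟩ := Finset.mem_image.1 (Finset.mem_coe.1 hx)
      exact ⟨k, rfl⟩)
  have := le_of_forall_powers_le_successProb (Nat.succ_pos n) hρ a ha
  rw [Real.exp_neg, ← one_div] at this
  push_cast at this
  linarith
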